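/- Let $E=(E^0,E^1,r,s)$ be a finite directed multigraph without sinks or sources in which every cycle has an exit. Let $C^*(E)$ be its graph $C^*$-algebra, i.e. the universal $C^*$-algebra generated by mutually orthogonal projections $P_v$ ($v\in E^0$) and partial isometries $S_e$ ($e\in E^1$) with $S_e^*S_e=P_{r(e)}$, $S_e^*S_f=0$ for $e\neq f$, $S_eS_e^*\le P_{s(e)}$, and $P_v=\sum_{s(e)=v}S_eS_e^*$ whenever $v$ emits an edge. Let $E^n$ be the set of paths of length $n$ (with $E^0$ the vertices). For $n\ge 1$ and a permutation $\tau$ of $E^n$ that preserves the source and the range of every path, put $U_\tau=\sum_{\alpha\in E^n}S_{\tau(\alpha)}S_\alpha^*$, and let $\lambda_\tau$ be the endomorphism of $C^*(E)$ with $\lambda_\tau(S_e)=U_\tau S_e$ and $\lambda_\tau(P_v)=P_v$ (a permutative endomorphism at level $n$). The permutation graph $(E_\tau,\mathcal L_\tau)$ of level $n$ has vertex set $E^{n-1}$ and edge set $E^n$; the edge $\mu$ has source $\tau(\mu)_1\cdots\tau(\mu)_{n-1}$, range $\mu_2\cdots\mu_n$, first label $\mu_1$ and second label $\tau(\mu)_n$.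 The first (second) label of a path over $E_\tau$ is the path over $E$ formed by the first (second) labels of its edges; for a path of length $0$ at the vertex $\beta\in E^{n-1}$ it is the vertex $s(\beta)$ (respectively $r(\beta)$). Let $\lambda_\tau$ and $\lambda_\pi$ be permutative endomorphisms of $C^*(E)$ at levels $l\ge1$ and $k\ge1$, where $\tau$ and $\pi$ are endpoint-fixing permutations of $E^l$ and $E^k$. Define a labeled graph $\Gamma$ with vertex set $E^{k+l-2}$ as follows. There is one edge of $\Gamma$ for each triple consisting of an edge of $E_\pi$ from $\beta\in E^{k-1}$ to $\alpha\in E^{k-1}$ with labels $[e,f]$ and a pair of paths $A$, $B$ over $E_\tau$ such that the first label of $A$ is $\alpha$, the first label of $B$ is $\beta f$, and $A$ and $B$ have the same range. If $\delta$, $\gamma\in E^{l-1}$ are the sources of $A$ and $B$, $\alpha'$ is the second label of $A$, and $\beta' g$ (with $g\in E^1$) is the second label of $B$, then this edge of $\Gamma$ goes from $\gamma\beta'$ to $\delta\alpha'$ and has the labels $[e,g]$. Then $\lambda_\tau\circ\lambda_\pi$ is a permutative endomorphism at level $k+l-1$: there is exactly one endpoint-fixing permutation $\sigma$ of $E^{k+l-1}$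 with $\lambda_\sigma=\lambda_\tau\circ\lambda_\pi$. Its permutation graph is $\Gamma$; that is, there is a bijection between the edges of $E_\sigma$ and those of $\Gamma$ that preserves sources, ranges and labels. -/

import Mathlib

universe u

/-- A directed multigraph with vertex set `V`, edge set `Edge`, source map `s` and range map `r`. -/
structure DirGraph (V Edge : Type u) where
  /-- source map -/
  s : Edge → V
  /-- range map -/
  r : Edge → V

namespace DirGraph

section Paths

variable {V Edge : Type u}

/-- `G.IsWalk v es`: the edge sequence `es` can be traversed in order, starting at `v`. -/
def IsWalk (G : DirGraph V Edge) : V → List Edge → Prop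
  | _, [] => True
  | v, e :: es => G.s e = v ∧ G.IsWalk (G.r e) es

/-- The vertex reached by traversing `es` from `v`. -/
def walkEnd (G : DirGraph V Edge) : V → List Edge → V
  | v, [] => v
  | _, e :: es => G.walkEnd (G.r e) es

/-- The set `Eⁿ` of paths of length `n`.  The starting vertex is recorded, so that paths of length
`0` are exactly the vertices; for `n ≥ 1` it is the source of the first edge. -/
@[ext]
structure Path (G : DirGraph V Edge) (n : ℕ) where
  src : V
  edges : List Edge
  length_eq : edges.length = n
  isWalk : G.IsWalk src edges

/-- The range of a path. -/
def Path.rng {G : DirGraph V Edge} {n : ℕ} (p : G.Path n) : V := G.walkEnd p.src p.edges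

variable {G : DirGraph V Edge}

theorem isWalk_append {v : V} {as bs : List Edge} :
    G.IsWalk v (as ++ bs) ↔ G.IsWalk v as ∧ G.IsWalk (G.walkEnd v as) bs := by
  induction as generalizing v with
  | nil => simp [IsWalk, walkEnd]
  | cons a as ih => simp [IsWalk, walkEnd, ih, and_assoc]

theorem walkEnd_append {v : V} {as bs : List Edge} :
    G.walkEnd v (as ++ bs) = G.walkEnd (G.walkEnd v as) bs := by
  induction as generalizing v with
  | nil => simp [walkEnd]
  | cons a as ih => simp [walkEnd, ih]

theorem Path.edges_ne_nil {n : ℕ} (p : G.Path (n + 1)) : p.edges ≠ [] := by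
  intro h
  have := p.length_eq
  simp [h] at this

/-- The first edge `μ₁` of a path `μ` of positive length. -/
def Path.head {n : ℕ} (p : G.Path (n + 1)) : Edge := p.edges.head p.edges_ne_nil

/-- The last edge of a path of positive length. -/
def Path.last {n : ℕ} (p : G.Path (n + 1)) : Edge := p.edges.getLast p.edges_ne_nil

theorem Path.s_head {n : ℕ} (p : G.Path (n + 1)) : G.s p.head = p.src := by
  obtain ⟨v, es, hl, hw⟩ := p
  cases es with
  | nil => simp at hl
  | cons e es => exact hw.1

/-- The path `μ₂ ⋯ μₙ₊₁` obtained from `μ₁ ⋯ μₙ₊₁` by dropping the first edge. -/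
def Path.tail {n : ℕ} (p : G.Path (n + 1)) : G.Path n where
  src := G.r p.head
  edges := p.edges.tail
  length_eq := by simp [p.length_eq]
  isWalk := by
    obtain ⟨v, es, hl, hw⟩ := p
    cases es with
    | nil => simp at hl
    | cons e es => exact hw.2

/-- The path `μ₁ ⋯ μₙ` obtained from `μ₁ ⋯ μₙ₊₁` by dropping the last edge. -/
def Path.init {n : ℕ} (p : G.Path (n + 1)) : G.Path n where
  src := p.src
  edges := p.edges.dropLast
  length_eq := by simp [p.length_eq]
  isWalk := by
    have h := p.isWalk
    rw [← List.dropLast_append_getLast p.edges_ne_nil, isWalk_append] at h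
    exact h.1

theorem Path.rng_tail {n : ℕ} (p : G.Path (n + 1)) : p.tail.rng = p.rng := by
  obtain ⟨v, es, hl, hw⟩ := p
  cases es with
  | nil => simp at hl
  | cons e es => rfl

theorem Path.s_last {n : ℕ} (p : G.Path (n + 1)) : G.s p.last = p.init.rng := by
  have h := p.isWalk
  rw [← List.dropLast_append_getLast p.edges_ne_nil, isWalk_append] at h
  exact h.2.1

theorem Path.r_last {n : ℕ} (p : G.Path (n + 1)) : G.r p.last = p.rng := by
  have h : G.walkEnd p.src (p.edges.dropLast ++ [p.edges.getLast p.edges_ne_nil]) = p.rng := by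
    rw [List.dropLast_append_getLast]; rfl
  rw [walkEnd_append] at h
  exact h

/-- The concatenation `pq` of two composable paths. -/
def Path.append {n m : ℕ} (p : G.Path n) (q : G.Path m) (h : p.rng = q.src) : G.Path (n + m) where
  src := p.src
  edges := p.edges ++ q.edges
  length_eq := by simp [p.length_eq, q.length_eq]
  isWalk := isWalk_append.2 ⟨p.isWalk, by
    have h' : G.walkEnd p.src p.edges = q.src := h
    rw [h']; exact q.isWalk⟩

/-- The path `eα`. -/
def Path.cons {n : ℕ} (e : Edge) (p : G.Path n) (h : G.r e = p.src) : G.Path (n + 1) where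
  src := G.s e
  edges := e :: p.edges
  length_eq := by simp [p.length_eq]
  isWalk := ⟨rfl, by rw [h]; exact p.isWalk⟩

theorem Path.cons_head_tail {n : ℕ} (p : G.Path (n + 1)) : Path.cons p.head p.tail rfl = p := by
  apply Path.ext
  · exact p.s_head
  · exact List.cons_head_tail p.edges_ne_nil

instance {n : ℕ} [Finite V] [Finite Edge] : Finite (G.Path n) :=
  Finite.of_injective
    (fun p : G.Path n => ((p.src, ⟨p.edges, p.length_eq⟩) : V × List.Vector Edge n)) (by
      intro p q h
      exact Path.ext (congrArg Prod.fst h)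
        (congrArg (fun x : V × List.Vector Edge n => x.2.1) h))

noncomputable instance {n : ℕ} [Finite V] [Finite Edge] : Fintype (G.Path n) :=
  Fintype.ofFinite _

/-- A morphism of directed graphs. -/
structure Hom {V' Edge' : Type u} (H : DirGraph V' Edge') (G : DirGraph V Edge) where
  onV : V' → V
  onE : Edge' → Edge
  s_onE : ∀ e, G.s (onE e) = onV (H.s e)
  r_onE : ∀ e, G.r (onE e) = onV (H.r e)

theorem Hom.isWalk_map {V' Edge' : Type u} {H : DirGraph V' Edge'} (φ : Hom H G) {v : V'}
    {es : List Edge'} (h : H.IsWalk v es) : G.IsWalk (φ.onV v) (es.map φ.onE) := by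
  induction es generalizing v with
  | nil => trivial
  | cons e es ih =>
    refine ⟨by rw [φ.s_onE, h.1], ?_⟩
    rw [φ.r_onE]
    exact ih h.2

/-- The image of a path under a graph morphism. -/
def Path.map {V' Edge' : Type u} {H : DirGraph V' Edge'} {n : ℕ} (φ : Hom H G) (p : H.Path n) :
    G.Path n where
  src := φ.onV p.src
  edges := p.edges.map φ.onE
  length_eq := by simp [p.length_eq]
  isWalk := φ.isWalk_map p.isWalk

/-- Every vertex emits an edge. -/
def NoSinks (G : DirGraph V Edge) : Prop := ∀ v, ∃ e, G.s e = v

/-- Every vertex receives an edge. -/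
def NoSources (G : DirGraph V Edge) : Prop := ∀ v, ∃ e, G.r e = v

/-- Every cycle (closed path of positive length) passes through a vertex, the source of one of
its edges, that emits at least two edges. -/
def EveryCycleHasExit (G : DirGraph V Edge) : Prop :=
  ∀ (n : ℕ) (μ : G.Path (n + 1)), μ.rng = μ.src →
    ∃ e ∈ μ.edges, ∃ f g, f ≠ g ∧ G.s f = G.s e ∧ G.s g = G.s e

end Paths

/-! ### The graph C⋆-algebra -/

section GraphAlgebra

variable {V Edge : Type u} [Fintype Edge]

open Classical in
/-- A Cuntz-Krieger `G`-family in a (possibly non-unital) C⋆-algebra `B`: mutually orthogonal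
projections `P v` and elements `S e` (automatically partial isometries, by `star_S_mul_S`) that
satisfy the relations of the graph C⋆-algebra.  The relation `S e * star (S e) ≤ P (s e)` between
projections is written as `P (s e) * (S e * star (S e)) = S e * star (S e)`. -/
structure CKFamily (G : DirGraph V Edge) (B : Type u) [NonUnitalCStarAlgebra B] where
  P : V → B
  S : Edge → B
  isStarProjection_P : ∀ v, IsStarProjection (P v)
  P_mul_P : ∀ v w, v ≠ w → P v * P w = 0
  star_S_mul_S : ∀ e, star (S e) * S e = P (G.r e)
  star_S_mul_S_of_ne : ∀ e f, e ≠ f → star (S e) * S f = 0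
  range_S_le : ∀ e, P (G.s e) * (S e * star (S e)) = S e * star (S e)
  P_eq_sum : ∀ v, (∃ e, G.s e = v) →
    P v = ∑ e ∈ Finset.univ.filter (fun e => G.s e = v), S e * star (S e)

/-- Formal `⋆`-polynomials (without constant term) in the generators `x : X`. -/
inductive StarPoly (X : Type u) : Type u
  | gen (x : X)
  | zero
  | add (a b : StarPoly X)
  | mul (a b : StarPoly X)
  | smul (c : ℂ) (a : StarPoly X)
  | adj (a : StarPoly X)

/-- Evaluation of `⋆`-polynomials. -/
def StarPoly.eval {X B : Type u} [NonUnitalCStarAlgebra B] (f : X → B) : StarPoly X → B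
  | gen x => f x
  | zero => 0
  | add a b => a.eval f + b.eval f
  | mul a b => a.eval f * b.eval f
  | smul c a => c • a.eval f
  | adj a => star (a.eval f)

variable {G : DirGraph V Edge}

/-- The generators `P v`, `S e` of a Cuntz-Krieger family as one function. -/
def CKFamily.gens {B : Type u} [NonUnitalCStarAlgebra B] (F : CKFamily G B) : V ⊕ Edge → B :=
  Sum.elim F.P F.S

theorem CKFamily.norm_P_le {B : Type u} [NonUnitalCStarAlgebra B] (F : CKFamily G B) (v : V) :
    ‖F.P v‖ ≤ 1 := by
  have h := CStarRing.norm_star_mul_self (x := F.P v)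
  rw [(F.isStarProjection_P v).isSelfAdjoint.star_eq,
    (F.isStarProjection_P v).isIdempotentElem.eq] at h
  nlinarith [norm_nonneg (F.P v)]

theorem CKFamily.norm_S_le {B : Type u} [NonUnitalCStarAlgebra B] (F : CKFamily G B) (e : Edge) :
    ‖F.S e‖ ≤ 1 := by
  have h := CStarRing.norm_star_mul_self (x := F.S e)
  rw [F.star_S_mul_S] at h
  nlinarith [norm_nonneg (F.S e), F.norm_P_le (G.r e)]

/-- The `⋆`-seminorms `t ↦ ‖t(P, S)‖` on `⋆`-polynomials that come from Cuntz-Krieger `G`-families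
`(P, S)` in C⋆-algebras. -/
def RepIndex (G : DirGraph V Edge) : Type u :=
  {N : StarPoly (V ⊕ Edge) → ℝ //
    ∃ (B : Type u) (_ : NonUnitalCStarAlgebra B) (F : CKFamily G B), ∀ t, N t = ‖t.eval F.gens‖}

/-- A C⋆-algebra that realizes the seminorm `i`. -/
def RepIndex.Carrier (i : RepIndex G) : Type u := i.2.choose

noncomputable instance (i : RepIndex G) : NonUnitalCStarAlgebra i.Carrier :=
  i.2.choose_spec.choose

/-- A Cuntz-Krieger family that realizes the seminorm `i`. -/
noncomputable def RepIndex.family (i : RepIndex G) : CKFamily G i.Carrier :=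
  i.2.choose_spec.choose_spec.choose

theorem RepIndex.norm_eval (i : RepIndex G) (t : StarPoly (V ⊕ Edge)) :
    i.1 t = ‖t.eval i.family.gens‖ :=
  i.2.choose_spec.choose_spec.choose_spec t

open scoped ENNReal in
/-- The C⋆-algebra of bounded families indexed by all representations. -/
abbrev RepProduct (G : DirGraph V Edge) : Type u := lp (fun i : RepIndex G => i.Carrier) ∞

theorem gens_memℓp (x : V ⊕ Edge) : Memℓp (fun i : RepIndex G => i.family.gens x) ⊤ := by
  apply memℓp_infty
  refine ⟨1, ?_⟩
  rintro _ ⟨i, rfl⟩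
  cases x with
  | inl v => exact i.family.norm_P_le v
  | inr e => exact i.family.norm_S_le e

/-- The tautological generators of the product. -/
noncomputable def prodGen (G : DirGraph V Edge) (x : V ⊕ Edge) : RepProduct G :=
  ⟨fun i => i.family.gens x, gens_memℓp x⟩

/-- The closed `⋆`-subalgebra generated by the tautological generators. -/
noncomputable def universalSubalgebra (G : DirGraph V Edge) :
    NonUnitalStarSubalgebra ℂ (RepProduct G) :=
  (NonUnitalStarAlgebra.adjoin ℂ (Set.range (prodGen G))).topologicalClosure

/-- The graph C⋆-algebra `C⋆(G)`: the universal C⋆-algebra generated by a Cuntz-Krieger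
`G`-family, realized as the closed `⋆`-subalgebra generated by the tautological family in the
product of all representations.  (It is separable, so that the universe of the representations
plays no role.)  Its universal property is `CStarAlg.lift`, `CStarAlg.hom_ext` below. -/
def CStarAlg (G : DirGraph V Edge) : Type u := universalSubalgebra G

noncomputable instance : NonUnitalCStarAlgebra (CStarAlg G) :=
  haveI : IsClosed (universalSubalgebra G : Set (RepProduct G)) :=
    NonUnitalStarSubalgebra.isClosed_topologicalClosure _
  inferInstanceAs (NonUnitalCStarAlgebra (universalSubalgebra G))



/-- The tautological generators of `C⋆(G)`. -/
noncomputable def algGen (G : DirGraph V Edge) (x : V ⊕ Edge) : CStarAlg G :=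
  ⟨prodGen G x, NonUnitalStarSubalgebra.le_topologicalClosure _
    (NonUnitalStarAlgebra.subset_adjoin ℂ _ ⟨x, rfl⟩)⟩

/-- Evaluation of an element of `C⋆(G)` in one of the representations. -/
noncomputable def coord (i : RepIndex G) (a : CStarAlg G) : i.Carrier := a.1 i

theorem coord_ext {a b : CStarAlg G} (h : ∀ i, coord i a = coord i b) : a = b :=
  Subtype.ext (lp.ext (funext h))

theorem coord_algGen (i : RepIndex G) (x : V ⊕ Edge) :
    coord i (algGen G x) = i.family.gens x := rfl

theorem coord_mul (i : RepIndex G) (a b : CStarAlg G) :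
    coord i (a * b) = coord i a * coord i b := rfl

theorem coord_add (i : RepIndex G) (a b : CStarAlg G) :
    coord i (a + b) = coord i a + coord i b := rfl

theorem coord_zero (i : RepIndex G) : coord i (0 : CStarAlg G) = 0 := rfl

theorem coord_smul (i : RepIndex G) (c : ℂ) (a : CStarAlg G) :
    coord i (c • a) = c • coord i a := rfl

theorem coord_star (i : RepIndex G) (a : CStarAlg G) :
    coord i (star a) = star (coord i a) := rfl

theorem coord_sum (i : RepIndex G) {ι : Type*} (s : Finset ι) (f : ι → CStarAlg G) :
    coord i (∑ j ∈ s, f j) = ∑ j ∈ s, coord i (f j) :=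
  map_sum (⟨⟨coord i, coord_zero i⟩, coord_add i⟩ : CStarAlg G →+ i.Carrier) f s

theorem coord_eval (i : RepIndex G) (t : StarPoly (V ⊕ Edge)) :
    coord i (t.eval (algGen G)) = t.eval i.family.gens := by
  induction t with
  | gen x => rfl
  | zero => rfl
  | add a b ha hb => simp only [StarPoly.eval, coord_add, ha, hb]
  | mul a b ha hb => simp only [StarPoly.eval, coord_mul, ha, hb]
  | smul c a ha => simp only [StarPoly.eval, coord_smul, ha]
  | adj a ha => simp only [StarPoly.eval, coord_star, ha]

theorem norm_coord_le (i : RepIndex G) (a : CStarAlg G) : ‖coord i a‖ ≤ ‖a‖ :=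
  lp.norm_apply_le_norm ENNReal.top_ne_zero a.1 i

/-- The universal Cuntz-Krieger `G`-family, generating `C⋆(G)`. -/
noncomputable def univFamily (G : DirGraph V Edge) : CKFamily G (CStarAlg G) where
  P v := algGen G (Sum.inl v)
  S e := algGen G (Sum.inr e)
  isStarProjection_P v := by
    refine ⟨coord_ext fun i => ?_, coord_ext fun i => ?_⟩
    · exact (i.family.isStarProjection_P v).isIdempotentElem
    · exact (i.family.isStarProjection_P v).isSelfAdjoint
  P_mul_P v w h := coord_ext fun i => i.family.P_mul_P v w h
  star_S_mul_S e := coord_ext fun i => i.family.star_S_mul_S e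
  star_S_mul_S_of_ne e f h := coord_ext fun i => i.family.star_S_mul_S_of_ne e f h
  range_S_le e := coord_ext fun i => i.family.range_S_le e
  P_eq_sum v h := coord_ext fun i => by
    rw [coord_sum]
    exact i.family.P_eq_sum v h

theorem univFamily_gens : (univFamily G).gens = algGen G := by
  funext x
  cases x <;> rfl

section Lift

variable {B : Type u} [NonUnitalCStarAlgebra B]

/-- In every representation, the norm of a `⋆`-polynomial is at most its norm in `C⋆(G)`. -/
theorem norm_eval_le (F : CKFamily G B) (t : StarPoly (V ⊕ Edge)) :
    ‖t.eval F.gens‖ ≤ ‖t.eval (algGen G)‖ := by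
  let i : RepIndex G := ⟨fun t => ‖t.eval F.gens‖, B, inferInstance, F, fun _ => rfl⟩
  have h := i.norm_eval t
  rw [← coord_eval] at h
  exact h.le.trans (norm_coord_le i _)

/-- The closed `⋆`-subalgebra of `C⋆(G) × B` that is the graph of the canonical map. -/
noncomputable def liftGraph (F : CKFamily G B) : NonUnitalStarSubalgebra ℂ (CStarAlg G × B) :=
  (NonUnitalStarAlgebra.adjoin ℂ
    (Set.range fun x : V ⊕ Edge => (algGen G x, F.gens x))).topologicalClosure

theorem exists_eval_of_mem_adjoin {C X : Type u} [NonUnitalCStarAlgebra C] (f : X → C) {c : C}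
    (hc : c ∈ NonUnitalStarAlgebra.adjoin ℂ (Set.range f)) : ∃ t : StarPoly X, t.eval f = c := by
  induction hc using NonUnitalStarAlgebra.adjoin_induction with
  | mem x hx => obtain ⟨y, rfl⟩ := hx; exact ⟨.gen y, rfl⟩
  | add x y _ _ hx hy =>
    obtain ⟨a, rfl⟩ := hx; obtain ⟨b, rfl⟩ := hy; exact ⟨.add a b, rfl⟩
  | zero => exact ⟨.zero, rfl⟩
  | mul x y _ _ hx hy =>
    obtain ⟨a, rfl⟩ := hx; obtain ⟨b, rfl⟩ := hy; exact ⟨.mul a b, rfl⟩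
  | smul r x _ hx => obtain ⟨a, rfl⟩ := hx; exact ⟨.smul r a, rfl⟩
  | star x _ hx => obtain ⟨a, rfl⟩ := hx; exact ⟨.adj a, rfl⟩

theorem eval_prod (F : CKFamily G B) (t : StarPoly (V ⊕ Edge)) :
    t.eval (fun x => (algGen G x, F.gens x)) = (t.eval (algGen G), t.eval F.gens) := by
  induction t with
  | gen x => rfl
  | zero => rfl
  | add a b ha hb => simp only [StarPoly.eval, ha, hb, Prod.mk_add_mk]
  | mul a b ha hb => simp only [StarPoly.eval, ha, hb, Prod.mk_mul_mk]
  | smul c a ha => simp only [StarPoly.eval, ha, Prod.smul_mk]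
  | adj a ha => simp only [StarPoly.eval, ha]; rfl

theorem norm_snd_le_of_mem_liftGraph (F : CKFamily G B) {z : CStarAlg G × B}
    (hz : z ∈ liftGraph F) : ‖z.2‖ ≤ ‖z.1‖ := by
  have hcl : IsClosed {z : CStarAlg G × B | ‖z.2‖ ≤ ‖z.1‖} :=
    isClosed_le (continuous_norm.comp continuous_snd) (continuous_norm.comp continuous_fst)
  refine closure_minimal ?_ hcl hz
  intro w hw
  obtain ⟨t, rfl⟩ := exists_eval_of_mem_adjoin _ hw
  rw [Set.mem_ofPred_eq, eval_prod]
  exact norm_eval_le F t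

/-- A closed `⋆`-subalgebra of `C⋆(G)` that contains the generators is everything. -/
theorem eq_top_of_algGen_mem (T : NonUnitalStarSubalgebra ℂ (CStarAlg G))
    (hT : IsClosed (T : Set (CStarAlg G))) (h : ∀ x, algGen G x ∈ T) (a : CStarAlg G) : a ∈ T := by
  have hcl : IsClosed (universalSubalgebra G : Set (RepProduct G)) :=
    NonUnitalStarSubalgebra.isClosed_topologicalClosure _
  let incl : CStarAlg G → RepProduct G := Subtype.val
  have hemb : Topology.IsClosedEmbedding incl := hcl.isClosedEmbedding_subtypeVal
  have himg : IsClosed (incl '' T) := hemb.isClosedMap _ hT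
  have hsub : (NonUnitalStarAlgebra.adjoin ℂ (Set.range (prodGen G)) : Set (RepProduct G)) ⊆
      incl '' T := by
    intro w hw
    obtain ⟨t, rfl⟩ := (by
      induction hw using NonUnitalStarAlgebra.adjoin_induction with
      | mem x hx => obtain ⟨y, rfl⟩ := hx; exact ⟨⟨_, h y⟩, rfl⟩
      | add x y _ _ hx hy =>
        obtain ⟨a, rfl⟩ := hx; obtain ⟨b, rfl⟩ := hy; exact ⟨a + b, rfl⟩
      | zero => exact ⟨0, rfl⟩
      | mul x y _ _ hx hy =>
        obtain ⟨a, rfl⟩ := hx; obtain ⟨b, rfl⟩ := hy; exact ⟨a * b, rfl⟩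
      | smul r x _ hx => obtain ⟨a, rfl⟩ := hx; exact ⟨r • a, rfl⟩
      | star x _ hx => obtain ⟨a, rfl⟩ := hx; exact ⟨star a, rfl⟩ :
      ∃ t : T, incl t.1 = w)
    exact ⟨t.1, t.2, rfl⟩
  obtain ⟨b, hb, hba⟩ := closure_minimal hsub himg a.2
  have : b = a := Subtype.ext hba
  exact this ▸ hb

theorem exists_mem_liftGraph (F : CKFamily G B) (a : CStarAlg G) :
    ∃ b, (a, b) ∈ liftGraph F := by
  have hcl : IsClosed (liftGraph F : Set (CStarAlg G × B)) :=
    NonUnitalStarSubalgebra.isClosed_topologicalClosure _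
  let φ : CStarAlg G × B →⋆ₙₐ[ℂ] CStarAlg G := NonUnitalStarAlgHom.fst ℂ _ _
  let T := (liftGraph F).map φ
  have hT : IsClosed (T : Set (CStarAlg G)) := by
    let ψ : liftGraph F → CStarAlg G := fun z => z.1.1
    have hψ : Isometry ψ := by
      refine Isometry.of_dist_eq fun z w => ?_
      have h := norm_snd_le_of_mem_liftGraph F (sub_mem z.2 w.2)
      rw [dist_eq_norm, Subtype.dist_eq, dist_eq_norm, Prod.norm_def]
      exact (max_eq_left h).symm
    have : CompleteSpace (liftGraph F) := hcl.completeSpace_coe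
    have : (T : Set (CStarAlg G)) = Set.range ψ := by
      ext x
      constructor
      · rintro ⟨z, hz, rfl⟩; exact ⟨⟨z, hz⟩, rfl⟩
      · rintro ⟨z, rfl⟩; exact ⟨z.1, z.2, rfl⟩
    rw [this]
    exact hψ.isClosedEmbedding.isClosed_range
  obtain ⟨z, hz, rfl⟩ := eq_top_of_algGen_mem T hT (fun x =>
    ⟨(algGen G x, F.gens x), NonUnitalStarSubalgebra.le_topologicalClosure _
      (NonUnitalStarAlgebra.subset_adjoin ℂ _ ⟨x, rfl⟩), rfl⟩) a
  exact ⟨z.2, hz⟩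

theorem liftGraph_unique (F : CKFamily G B) {a : CStarAlg G} {b c : B}
    (hb : (a, b) ∈ liftGraph F) (hc : (a, c) ∈ liftGraph F) : b = c := by
  have h := norm_snd_le_of_mem_liftGraph F (sub_mem hb hc)
  simpa [sub_eq_zero] using h

/-- The universal property of `C⋆(G)`: a Cuntz-Krieger family in a C⋆-algebra `B` induces a
`⋆`-homomorphism `C⋆(G) → B`. -/
noncomputable def CStarAlg.lift (F : CKFamily G B) : CStarAlg G →⋆ₙₐ[ℂ] B where
  toFun a := (exists_mem_liftGraph F a).choose
  map_smul' c a := liftGraph_unique F (exists_mem_liftGraph F (c • a)).choose_spec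
    ((liftGraph F).smul_mem (r := c) (exists_mem_liftGraph F a).choose_spec)
  map_zero' := liftGraph_unique F (exists_mem_liftGraph F 0).choose_spec
    (zero_mem (liftGraph F))
  map_add' a b := liftGraph_unique F (exists_mem_liftGraph F (a + b)).choose_spec
    (add_mem (exists_mem_liftGraph F a).choose_spec (exists_mem_liftGraph F b).choose_spec)
  map_mul' a b := liftGraph_unique F (exists_mem_liftGraph F (a * b)).choose_spec
    (mul_mem (exists_mem_liftGraph F a).choose_spec (exists_mem_liftGraph F b).choose_spec)
  map_star' a := liftGraph_unique F (exists_mem_liftGraph F (star a)).choose_spec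
    (star_mem (exists_mem_liftGraph F a).choose_spec)

theorem CStarAlg.lift_algGen (F : CKFamily G B) (x : V ⊕ Edge) :
    CStarAlg.lift F (algGen G x) = F.gens x :=
  liftGraph_unique F (exists_mem_liftGraph F _).choose_spec
    (NonUnitalStarSubalgebra.le_topologicalClosure _
      (NonUnitalStarAlgebra.subset_adjoin ℂ _ ⟨x, rfl⟩))

theorem CStarAlg.lift_P (F : CKFamily G B) (v : V) :
    CStarAlg.lift F ((univFamily G).P v) = F.P v := CStarAlg.lift_algGen F (Sum.inl v)

theorem CStarAlg.lift_S (F : CKFamily G B) (e : Edge) :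
    CStarAlg.lift F ((univFamily G).S e) = F.S e := CStarAlg.lift_algGen F (Sum.inr e)

/-- A `⋆`-homomorphism on `C⋆(G)` is determined by its values on the generators. -/
theorem CStarAlg.hom_ext {φ ψ : CStarAlg G →⋆ₙₐ[ℂ] B}
    (hP : ∀ v, φ ((univFamily G).P v) = ψ ((univFamily G).P v))
    (hS : ∀ e, φ ((univFamily G).S e) = ψ ((univFamily G).S e)) : φ = ψ := by
  ext a
  have hcont : ∀ χ : CStarAlg G →⋆ₙₐ[ℂ] B, Continuous χ := fun χ =>
    AddMonoidHomClass.continuous_of_bound χ 1 fun a => by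
      rw [one_mul]; exact NonUnitalStarAlgHom.norm_apply_le χ a
  refine eq_top_of_algGen_mem (NonUnitalStarAlgHom.equalizer φ ψ)
    (isClosed_eq (hcont φ) (hcont ψ)) ?_ a
  rintro (v | e)
  · exact hP v
  · exact hS e

end Lift
end GraphAlgebra

/-! ### Permutative endomorphisms -/

section Permutative

variable {V Edge : Type u} {G : DirGraph V Edge}

/-- An endpoint-fixing permutation of `Eⁿ`: it maps each set `Eⁿ_{u → v}` of paths with given source
and range (hence, being a bijection, onto) itself. -/
structure EndpointPerm (G : DirGraph V Edge) (n : ℕ) where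
  toPerm : Equiv.Perm (G.Path n)
  src_eq : ∀ α, (toPerm α).src = α.src
  rng_eq : ∀ α, (toPerm α).rng = α.rng

namespace CKFamily

variable [Fintype Edge] {B : Type u} [NonUnitalCStarAlgebra B] (F : CKFamily G B)

/-- `S_{e₁} ⋯ S_{eₙ} P_{r(eₙ)}` (which is `S_{e₁} ⋯ S_{eₙ}` if `n ≥ 1`), and `P_v` for the path of
length `0` at `v`. -/
def walkS : V → List Edge → B
  | v, [] => F.P v
  | _, e :: es => F.S e * walkS (G.r e) es

/-- The partial isometry `S_α` of a path `α`. -/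
def pathS {n : ℕ} (p : G.Path n) : B := F.walkS p.src p.edges

/-- The element `U_τ = ∑ S_{τ(α)} S_α^*`, where `α` runs over all paths of length `n`. -/
noncomputable def permUnitary [Fintype V] {n : ℕ} (τ : G.EndpointPerm n) : B :=
  ∑ α : G.Path n, F.pathS (τ.toPerm α) * star (F.pathS α)

theorem star_P (v : V) : star (F.P v) = F.P v := (F.isStarProjection_P v).isSelfAdjoint

theorem P_mul_self (v : V) : F.P v * F.P v = F.P v := (F.isStarProjection_P v).isIdempotentElem

theorem S_mul_P (e : Edge) : F.S e * F.P (G.r e) = F.S e := by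
  rw [← sub_eq_zero, ← CStarRing.star_mul_self_eq_zero_iff]
  simp only [star_sub, star_mul, F.star_P, sub_mul, mul_sub]
  simp only [← mul_assoc, mul_assoc _ (star (F.S e)) (F.S e), F.star_S_mul_S, F.P_mul_self]
  simp

theorem P_mul_S (e : Edge) : F.P (G.s e) * F.S e = F.S e := by
  have h := F.range_S_le e
  have h' : F.S e * star (F.S e) * F.P (G.s e) = F.S e * star (F.S e) := by
    have := congrArg star h
    simpa [star_mul, F.star_P, mul_assoc] using this
  rw [← sub_eq_zero, ← CStarRing.mul_star_self_eq_zero_iff]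
  simp only [star_sub, star_mul, F.star_P, sub_mul, mul_sub]
  simp only [← mul_assoc] at h ⊢
  rw [h, h', sub_self]

theorem P_mul_S_of_ne {v : V} {e : Edge} (h : v ≠ G.s e) : F.P v * F.S e = 0 := by
  rw [← F.P_mul_S, ← mul_assoc, F.P_mul_P _ _ h, zero_mul]

open Classical in
theorem P_mul_walkS (v w : V) {es : List Edge} (h : G.IsWalk w es) :
    F.P v * F.walkS w es = if v = w then F.walkS w es else 0 := by
  cases es with
  | nil =>
    split_ifs with hv
    · rw [hv]; exact F.P_mul_self w
    · exact F.P_mul_P _ _ hv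
  | cons e es =>
    have hw : G.s e = w := h.1
    subst hw
    simp only [walkS, ← mul_assoc]
    split_ifs with hv
    · rw [hv, F.P_mul_S]
    · rw [F.P_mul_S_of_ne hv, zero_mul]

theorem walkS_mul_P (v : V) (es : List Edge) :
    F.walkS v es * F.P (G.walkEnd v es) = F.walkS v es := by
  induction es generalizing v with
  | nil => exact F.P_mul_self v
  | cons e es ih => simp only [walkS, walkEnd, mul_assoc, ih]

open Classical in
theorem star_walkS_mul_walkS {v w : V} {as bs : List Edge} (ha : G.IsWalk v as)
    (hb : G.IsWalk w bs) (hl : as.length = bs.length) :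
    star (F.walkS v as) * F.walkS w bs =
      if v = w ∧ as = bs then F.P (G.walkEnd v as) else 0 := by
  induction as generalizing v w bs with
  | nil =>
    cases bs with
    | cons b bs => simp at hl
    | nil =>
      simp only [walkS, walkEnd, F.star_P, and_true]
      split_ifs with h
      · rw [h]; exact F.P_mul_self w
      · exact F.P_mul_P _ _ h
  | cons a as ih =>
    cases bs with
    | nil => simp at hl
    | cons b bs =>
      have h1 : G.s a = v := ha.1
      have h2 : G.s b = w := hb.1
      simp only [walkS, star_mul, walkEnd]
      by_cases hab : a = b
      · subst hab
        have hvw : v = w := h1.symm.trans h2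
        rw [mul_assoc, ← mul_assoc (star (F.S a)), F.star_S_mul_S, F.P_mul_walkS _ _ hb.2,
          if_pos rfl, ih ha.2 hb.2 (by simpa using hl)]
        simp [hvw]
      · rw [mul_assoc, ← mul_assoc (star (F.S a)), F.star_S_mul_S_of_ne _ _ hab]
        simp [hab]

open Classical in
theorem star_pathS_mul_pathS {n : ℕ} (p q : G.Path n) :
    star (F.pathS p) * F.pathS q = if p = q then F.P p.rng else 0 := by
  unfold pathS
  rw [F.star_walkS_mul_walkS p.isWalk q.isWalk (p.length_eq.trans q.length_eq.symm)]
  simp only [Path.ext_iff, Path.rng]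

open Classical in
theorem P_mul_pathS {n : ℕ} (v : V) (p : G.Path n) :
    F.P v * F.pathS p = if v = p.src then F.pathS p else 0 := F.P_mul_walkS v p.src p.isWalk

theorem pathS_mul_P {n : ℕ} (p : G.Path n) : F.pathS p * F.P p.rng = F.pathS p :=
  F.walkS_mul_P _ _

theorem pathS_head_tail {n : ℕ} (p : G.Path (n + 1)) :
    F.pathS p = F.S p.head * F.pathS p.tail := by
  conv_lhs => rw [← p.cons_head_tail]
  rfl

variable [Fintype V]

theorem sum_P_mul_S (e : Edge) : (∑ v, F.P v) * F.S e = F.S e := by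
  rw [Finset.sum_mul, Finset.sum_eq_single (G.s e), F.P_mul_S]
  · intro v _ hv; exact F.P_mul_S_of_ne hv
  · simp

theorem sum_P_mul_P (v : V) : (∑ w, F.P w) * F.P v = F.P v := by
  rw [Finset.sum_mul, Finset.sum_eq_single v, F.P_mul_self]
  · intro w _ hw; exact F.P_mul_P _ _ hw
  · simp

theorem sum_S_mul_star (hG : G.NoSinks) : ∑ e, F.S e * star (F.S e) = ∑ v, F.P v := by
  classical
  rw [← Finset.sum_fiberwise_of_maps_to (s := Finset.univ) (t := Finset.univ) (g := G.s)
    (fun _ _ => Finset.mem_univ _)]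
  refine Finset.sum_congr rfl fun v _ => ?_
  rw [F.P_eq_sum v (hG v)]


theorem sum_pathS_mul_star (hG : G.NoSinks) (n : ℕ) :
    ∑ p : G.Path n, F.pathS p * star (F.pathS p) = ∑ v, F.P v := by
  classical
  induction n with
  | zero =>
    refine Fintype.sum_bijective (fun p : G.Path 0 => p.src) ⟨?_, ?_⟩ _ _ ?_
    · intro p q h
      refine Path.ext h ?_
      rw [List.eq_nil_of_length_eq_zero p.length_eq, List.eq_nil_of_length_eq_zero q.length_eq]
    · intro v
      exact ⟨⟨v, [], rfl, trivial⟩, rfl⟩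
    · rintro ⟨v, es, hl, hw⟩
      obtain rfl := List.eq_nil_of_length_eq_zero hl
      simp only [pathS, walkS, F.star_P, F.P_mul_self]
  | succ n ih =>
    have h1 : ∑ p : G.Path (n + 1), F.pathS p * star (F.pathS p) =
        ∑ x : Edge × G.Path n, F.S x.1 * (F.pathS x.2 * star (F.pathS x.2)) * star (F.S x.1) := by
      refine Finset.sum_of_injOn (fun p => (p.head, p.tail)) ?_ (fun _ _ => by simp) ?_ ?_
      · intro p _ q _ h
        rw [← p.cons_head_tail, ← q.cons_head_tail]
        simp only [Prod.mk.injEq] at h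
        obtain ⟨ha, hb⟩ := h
        exact Path.ext (congrArg G.s ha)
          (congrArg₂ List.cons ha (congrArg Path.edges hb))
      · rintro ⟨e, q⟩ _ hx
        have hne : G.r e ≠ q.src := by
          intro h
          refine hx ⟨Path.cons e q h, by simp, ?_⟩
          refine Prod.ext rfl (Path.ext h rfl)
        dsimp only
        rw [← F.S_mul_P e, mul_assoc (F.S e), ← mul_assoc (F.P _), F.P_mul_pathS, if_neg hne]
        simp
      · intro p _
        rw [F.pathS_head_tail p]
        simp only [star_mul, mul_assoc]
    rw [h1, Fintype.sum_prod_type, ← F.sum_S_mul_star hG]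
    refine Finset.sum_congr rfl fun e _ => ?_
    dsimp only
    rw [← Finset.sum_mul, ← Finset.mul_sum, ih]
    have h3 : F.S e * (∑ v, F.P v) = F.S e := by
      rw [← F.S_mul_P e, mul_assoc, Finset.mul_sum, Finset.sum_eq_single (G.r e), F.P_mul_self]
      · intro w _ hw; exact F.P_mul_P _ _ hw.symm
      · simp
    rw [h3]

theorem star_permUnitary_mul_self (hG : G.NoSinks) {n : ℕ} (τ : G.EndpointPerm n) :
    star (F.permUnitary τ) * F.permUnitary τ = ∑ v, F.P v := by
  classical
  rw [← F.sum_pathS_mul_star hG n]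
  simp only [permUnitary, star_sum, Finset.sum_mul, Finset.mul_sum, star_mul, star_star]
  refine Finset.sum_congr rfl fun α _ => ?_
  rw [Finset.sum_eq_single α]
  · rw [mul_assoc, ← mul_assoc (star (F.pathS (τ.toPerm α))), F.star_pathS_mul_pathS, if_pos rfl,
      τ.rng_eq, ← mul_assoc, F.pathS_mul_P]
  · intro β _ hβ
    rw [mul_assoc, ← mul_assoc (star (F.pathS _)), F.star_pathS_mul_pathS,
      if_neg (fun h => hβ (by simpa using h))]
    simp
  · simp

theorem permUnitary_mul_star_self (hG : G.NoSinks) {n : ℕ} (τ : G.EndpointPerm n) :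
    F.permUnitary τ * star (F.permUnitary τ) = ∑ v, F.P v := by
  classical
  rw [← F.sum_pathS_mul_star hG n, ← Equiv.sum_comp τ.toPerm]
  simp only [permUnitary, star_sum, Finset.sum_mul, Finset.mul_sum, star_mul, star_star]
  refine Finset.sum_congr rfl fun α _ => ?_
  rw [Finset.sum_eq_single α]
  · rw [mul_assoc, ← mul_assoc (star (F.pathS α)), F.star_pathS_mul_pathS, if_pos rfl,
      ← τ.rng_eq, ← mul_assoc, F.pathS_mul_P]
  · intro β _ hβ
    rw [mul_assoc, ← mul_assoc (star (F.pathS _)), F.star_pathS_mul_pathS,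
      if_neg hβ]
    simp
  · simp

theorem P_mul_permUnitary {n : ℕ} (τ : G.EndpointPerm n) (v : V) :
    F.P v * F.permUnitary τ = F.permUnitary τ * F.P v := by
  classical
  simp only [permUnitary, Finset.sum_mul, Finset.mul_sum]
  refine Finset.sum_congr rfl fun α _ => ?_
  have h : star (F.pathS α) * F.P v = if v = α.src then star (F.pathS α) else 0 := by
    have := congrArg star (F.P_mul_pathS v α)
    rw [star_mul, F.star_P] at this
    rw [this]
    split_ifs <;> simp
  rw [← mul_assoc, F.P_mul_pathS, mul_assoc, h, τ.src_eq]
  split_ifs <;> simp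

/-- The Cuntz-Krieger family `P_v`, `U_τ S_e`. -/
noncomputable def permute (hG : G.NoSinks) {n : ℕ} (τ : G.EndpointPerm n) : CKFamily G B where
  P := F.P
  S e := F.permUnitary τ * F.S e
  isStarProjection_P := F.isStarProjection_P
  P_mul_P := F.P_mul_P
  star_S_mul_S e := by
    rw [star_mul, mul_assoc, ← mul_assoc (star (F.permUnitary τ)),
      F.star_permUnitary_mul_self hG, F.sum_P_mul_S, F.star_S_mul_S]
  star_S_mul_S_of_ne e f h := by
    rw [star_mul, mul_assoc, ← mul_assoc (star (F.permUnitary τ)),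
      F.star_permUnitary_mul_self hG, F.sum_P_mul_S, F.star_S_mul_S_of_ne e f h]
  range_S_le e := by
    rw [← mul_assoc, ← mul_assoc, F.P_mul_permUnitary, mul_assoc (F.permUnitary τ), F.P_mul_S]
  P_eq_sum v hv := by
    have h1 : F.permUnitary τ * F.P v * star (F.permUnitary τ) = F.P v := by
      rw [← F.P_mul_permUnitary, mul_assoc, F.permUnitary_mul_star_self hG, ← star_inj,
        star_mul, star_sum]
      simp only [F.star_P]
      exact F.sum_P_mul_P v
    rw [← h1]
    conv_lhs => rw [F.P_eq_sum v hv, Finset.mul_sum, Finset.sum_mul]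
    refine Finset.sum_congr rfl fun e _ => ?_
    simp only [star_mul, mul_assoc]

end CKFamily

/-- The permutative endomorphism `λ_τ` of `C⋆(G)`: the `⋆`-homomorphism with
`λ_τ(S_e) = U_τ S_e` and `λ_τ(P_v) = P_v`.  (In particular it preserves the unit `∑ P_v`.) -/
noncomputable def permEndo [Fintype V] [Fintype Edge] (hG : G.NoSinks) {n : ℕ}
    (τ : G.EndpointPerm n) : CStarAlg G →⋆ₙₐ[ℂ] CStarAlg G :=
  CStarAlg.lift ((univFamily G).permute hG τ)

theorem permEndo_S [Fintype V] [Fintype Edge] (hG : G.NoSinks) {n : ℕ} (τ : G.EndpointPerm n)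
    (e : Edge) :
    permEndo hG τ ((univFamily G).S e) = (univFamily G).permUnitary τ * (univFamily G).S e :=
  CStarAlg.lift_S _ e

theorem permEndo_P [Fintype V] [Fintype Edge] (hG : G.NoSinks) {n : ℕ} (τ : G.EndpointPerm n)
    (v : V) : permEndo hG τ ((univFamily G).P v) = (univFamily G).P v :=
  CStarAlg.lift_P _ v

end Permutative

/-! ### Permutation graphs and their composition -/

section PermutationGraph

variable {V Edge : Type u} {G : DirGraph V Edge}

/-- A labeled graph with vertex set `V'` and labels in `L`. -/
structure LabeledGraph (V' : Type u) (L : Type u) where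
  EdgeSet : Type u
  graph : DirGraph V' EdgeSet
  label : EdgeSet → L

/-- Two labeled graphs on the same vertex set agree: their edges are in a bijection that preserves
sources, ranges and labels. -/
def LabeledGraph.Same {V' L : Type u} (Γ Δ : LabeledGraph V' L) : Prop :=
  ∃ φ : Γ.EdgeSet ≃ Δ.EdgeSet, ∀ μ, Δ.graph.s (φ μ) = Γ.graph.s μ ∧
    Δ.graph.r (φ μ) = Γ.graph.r μ ∧ Δ.label (φ μ) = Γ.label μ

variable {n k l : ℕ}

/-- The graph `E_τ` of an endpoint-fixing permutation `τ` of `E^{n+1}`: vertices are the paths of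
length `n`, edges the paths `μ` of length `n+1`, `s_τ(μ) = τ(μ)₁ ⋯ τ(μ)ₙ`, `r_τ(μ) = μ₂ ⋯ μₙ₊₁`. -/
def permDirGraph (τ : G.EndpointPerm (n + 1)) : DirGraph (G.Path n) (G.Path (n + 1)) where
  s μ := (τ.toPerm μ).init
  r μ := μ.tail

/-- The first label `μ₁`. -/
def label₁ (_τ : G.EndpointPerm (n + 1)) (μ : G.Path (n + 1)) : Edge := μ.head

/-- The second label `τ(μ)ₙ₊₁`. -/
def label₂ (τ : G.EndpointPerm (n + 1)) (μ : G.Path (n + 1)) : Edge := (τ.toPerm μ).last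

/-- The permutation graph `(E_τ, L_τ)`, of level `n + 1`. -/
def permGraph (τ : G.EndpointPerm (n + 1)) : LabeledGraph (G.Path n) (Edge × Edge) where
  EdgeSet := G.Path (n + 1)
  graph := permDirGraph τ
  label μ := (label₁ τ μ, label₂ τ μ)

/-- The first label as a graph morphism `E_τ → E`; on vertices it is the source of a path. -/
def label₁Hom (τ : G.EndpointPerm (n + 1)) : Hom (permDirGraph τ) G where
  onV β := β.src
  onE := label₁ τ
  s_onE μ := μ.s_head.trans (τ.src_eq μ).symm
  r_onE _ := rfl

/-- The second label as a graph morphism `E_τ → E`; on vertices it is the range of a path. -/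
def label₂Hom (τ : G.EndpointPerm (n + 1)) : Hom (permDirGraph τ) G where
  onV β := β.rng
  onE := label₂ τ
  s_onE μ := (τ.toPerm μ).s_last
  r_onE μ := (τ.toPerm μ).r_last.trans ((τ.rng_eq μ).trans μ.rng_tail.symm)

/-- The first label of a path over `E_τ`, a path over `E` of the same length.  For a path of length
`0` at the vertex `β` this is the vertex `s(β)`. -/
def firstLabel (τ : G.EndpointPerm (n + 1)) {m : ℕ} (A : (permDirGraph τ).Path m) : G.Path m :=
  A.map (label₁Hom τ)

/-- The second label of a path over `E_τ`, a path over `E` of the same length.  For a path of length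
`0` at the vertex `β` this is the vertex `r(β)`. -/
def secondLabel (τ : G.EndpointPerm (n + 1)) {m : ℕ} (A : (permDirGraph τ).Path m) : G.Path m :=
  A.map (label₂Hom τ)

/-- The edges of the composed graph: an edge `β → α` of `E_π` with labels `[e, f]`, together with a
pair of paths `A`, `B` over `E_τ` with a common range, such that the first label of `A` is `α` and
the first label of `B` is `β f`. -/
structure CompEdge (τ : G.EndpointPerm (l + 1)) (π : G.EndpointPerm (k + 1)) : Type u where
  edge : G.Path (k + 1)
  A : (permDirGraph τ).Path k
  B : (permDirGraph τ).Path (k + 1)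
  firstLabel_A : firstLabel τ A = (permDirGraph π).r edge
  firstLabel_B_init : (firstLabel τ B).init = (permDirGraph π).s edge
  firstLabel_B_last : (firstLabel τ B).last = label₂ π edge
  rng_eq : A.rng = B.rng

/-- The composed labeled graph: the edge given by `β → α` (labeled `[e, f]`) and `A`, `B` goes from
`γ β'` to `δ α'` and is labeled `[e, g]`, where `γ`, `δ` are the sources of `B`, `A`, and `β' g`,
`α'` are the second labels of `B`, `A`. -/
def compGraph (τ : G.EndpointPerm (l + 1)) (π : G.EndpointPerm (k + 1)) :
    LabeledGraph (G.Path (l + k)) (Edge × Edge) where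
  EdgeSet := CompEdge τ π
  graph :=
    { s := fun x => x.B.src.append (secondLabel τ x.B).init rfl
      r := fun x => x.A.src.append (secondLabel τ x.A) rfl }
  label x := (label₁ π x.edge, (secondLabel τ x.B).last)

end PermutationGraph

end DirGraph

/-!
Write `F` for the universal Cuntz-Krieger family and `F'` for the family `P_v`, `U_τ S_e`, so that
`λ_τ` maps `F` to `F'`, and `λ_τ ∘ λ_π` maps `S_e` to `U'_π U_τ S_e`, where `U'_π` is the element
`U_π` formed in the family `F'`.

Let `A` be a path over `E_τ` with source `δ`, range `ω`, first label `α` and second label `α'`.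
Since `U_τ S_μ = S_{τ(μ)}` for all edges `μ` of `E_τ`, an induction on the length of `A` gives
`S'_α S_ω = S_{δα'}` (`CKFamily.permute_pathS_firstLabel_mul`).  For an edge `x` of `Γ` given by an
edge `eα` of `E_π` and by paths `A`, `B` with a common range `ω` and first labels `α`, `π(eα)`,
this implies
`U'_π U_τ S_e S_{δα'} = U'_π S'_{eα} S_ω = S'_{π(eα)} S_ω = S_{γβ'g}`,
where `γ` and `β'g` are the source and the second label of `B`.  Hence `λ_τ ∘ λ_π = λ_σ` if
`σ(eδα') = γβ'g` for every edge of `Γ` (`permEndo_compPerm`), and then `x ↦ eδα'` identifies `Γ`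
with `E_σ` (`permGraph_compPerm_same`).

That this defines a permutation `σ` means that `x ↦ eδα'` and `x ↦ γβ'g` are bijections from the
edges of `Γ` onto the paths of the length of `eδα'` (`CompEdge.inPath_bijective`,
`CompEdge.outPath_bijective`).  This holds because a path over `E_τ` can be prescribed, uniquely,
by its source and its second label, and also by its range and its first label.

The permutation `σ` is unique since the `S_α` with `α ∈ E^n` are distinct: they have orthogonal
ranges, and `S_α^* S_α = P_{r(α)}` does not vanish, which is seen in a Cuntz-Krieger family of
operators on `ℓ²(V × ℕ)` (`exists_family_P_ne_zero`).
-/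

namespace DirGraph

/-! ### Paths -/

section PathLemmas

variable {V Edge : Type u} {G : DirGraph V Edge}

theorem Path.rng_append {n m : ℕ} (p : G.Path n) (q : G.Path m) (h : p.rng = q.src) :
    (p.append q h).rng = q.rng := by
  have h' : G.walkEnd p.src p.edges = q.src := h
  simp only [Path.rng, Path.append, walkEnd_append, h']

theorem Path.rng_cons {n : ℕ} (e : Edge) (p : G.Path n) (h : G.r e = p.src) :
    (Path.cons e p h).rng = p.rng := by
  simp only [Path.rng, Path.cons, walkEnd, h]

/-- Every path of length `n + m` is a concatenation of paths of lengths `n` and `m`. -/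
theorem Path.exists_append_eq {n m : ℕ} (p : G.Path (n + m)) :
    ∃ (q : G.Path n) (q' : G.Path m) (h : q.rng = q'.src), q.append q' h = p := by
  have hw := p.isWalk
  rw [← List.take_append_drop n p.edges, isWalk_append] at hw
  refine ⟨⟨p.src, p.edges.take n, by simp [p.length_eq], hw.1⟩,
    ⟨_, p.edges.drop n, by simp [p.length_eq], hw.2⟩, rfl, ?_⟩
  exact Path.ext rfl (List.take_append_drop n p.edges)

theorem Path.append_inj {n m : ℕ} {p p' : G.Path n} {q q' : G.Path m} {h : p.rng = q.src}
    {h' : p'.rng = q'.src} (heq : p.append q h = p'.append q' h') : p = p' ∧ q = q' := by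
  have hsrc : p.src = p'.src := congrArg (fun x : G.Path (n + m) => x.src) heq
  obtain ⟨h₁, h₂⟩ := List.append_inj (congrArg Path.edges heq)
    (p.length_eq.trans p'.length_eq.symm)
  have hp : p = p' := Path.ext hsrc h₁
  subst hp
  exact ⟨rfl, Path.ext (h.symm.trans h') h₂⟩

theorem Path.cons_inj {n : ℕ} {e e' : Edge} {p p' : G.Path n} {h : G.r e = p.src}
    {h' : G.r e' = p'.src} (heq : Path.cons e p h = Path.cons e' p' h') : e = e' ∧ p = p' := by
  obtain ⟨rfl, hl⟩ := List.cons_eq_cons.1 (congrArg Path.edges heq)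
  exact ⟨rfl, Path.ext (h.symm.trans h') hl⟩

theorem Path.ext_head_tail {n : ℕ} {p q : G.Path (n + 1)} (hh : p.head = q.head)
    (ht : p.tail = q.tail) : p = q := by
  rw [← p.cons_head_tail, ← q.cons_head_tail]
  exact Path.ext (congrArg G.s hh) (congrArg₂ List.cons hh (congrArg Path.edges ht))

theorem Path.ext_init_last {n : ℕ} {p q : G.Path (n + 1)} (hi : p.init = q.init)
    (hl : p.last = q.last) : p = q := by
  refine Path.ext (congrArg (fun x => x.src) hi) ?_
  rw [← List.dropLast_append_getLast p.edges_ne_nil, ← List.dropLast_append_getLast q.edges_ne_nil]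
  exact congrArg₂ (· ++ [·]) (congrArg Path.edges hi) hl

/-- The path `αe`. -/
def Path.snoc {n : ℕ} (p : G.Path n) (e : Edge) (h : G.s e = p.rng) : G.Path (n + 1) :=
  p.append (⟨G.s e, [e], rfl, rfl, trivial⟩ : G.Path 1) h.symm

theorem Path.init_snoc {n : ℕ} (p : G.Path n) (e : Edge) (h : G.s e = p.rng) :
    (p.snoc e h).init = p :=
  Path.ext rfl (List.dropLast_concat (l₁ := p.edges) (b := e))

theorem Path.last_snoc {n : ℕ} (p : G.Path n) (e : Edge) (h : G.s e = p.rng) :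
    (p.snoc e h).last = e :=
  List.getLast_append_of_ne_nil (l := p.edges) (by simp) (by simp)

theorem Path.init_append {n m : ℕ} (p : G.Path n) (q : G.Path (m + 1)) (h : p.rng = q.src) :
    Path.init (n := n + m) (p.append q h) = p.append q.init h :=
  Path.ext rfl (List.dropLast_append_of_ne_nil q.edges_ne_nil)

theorem Path.last_append {n m : ℕ} (p : G.Path n) (q : G.Path (m + 1)) (h : p.rng = q.src) :
    Path.last (n := n + m) (p.append q h) = q.last :=
  List.getLast_append_of_ne_nil _ q.edges_ne_nil

theorem Hom.walkEnd_map {V' Edge' : Type u} {H : DirGraph V' Edge'} (φ : Hom H G) (v : V')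
    (es : List Edge') : G.walkEnd (φ.onV v) (es.map φ.onE) = φ.onV (H.walkEnd v es) := by
  induction es generalizing v with
  | nil => rfl
  | cons e es ih => rw [List.map_cons, walkEnd, φ.r_onE, ih, walkEnd]

theorem Path.rng_map {V' Edge' : Type u} {H : DirGraph V' Edge'} (φ : Hom H G) {n : ℕ}
    (p : H.Path n) : (p.map φ).rng = φ.onV p.rng :=
  φ.walkEnd_map _ _

/-- If every edge lifts uniquely to an edge with prescribed source, then so does every path. -/
theorem Hom.existsUnique_path_of_src {V' Edge' : Type u} {H : DirGraph V' Edge'} (φ : Hom H G)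
    (hφ : ∀ (v : V') (e : Edge), G.s e = φ.onV v → ∃! e', H.s e' = v ∧ φ.onE e' = e)
    {n : ℕ} (v : V') (p : G.Path n) (h : p.src = φ.onV v) :
    ∃! q : H.Path n, q.src = v ∧ q.map φ = p := by
  have key : ∀ (es : List Edge) (v : V'), G.IsWalk (φ.onV v) es →
      ∃! es' : List Edge', H.IsWalk v es' ∧ es'.map φ.onE = es := by
    intro es
    induction es with
    | nil => exact fun v _ => ⟨[], ⟨trivial, rfl⟩, fun y hy => List.map_eq_nil_iff.1 hy.2⟩
    | cons e es ih =>
      rintro v ⟨hs, hw⟩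
      obtain ⟨e', ⟨rfl, rfl⟩, hu⟩ := hφ v e hs
      rw [φ.r_onE] at hw
      obtain ⟨es', ⟨hw', rfl⟩, hu'⟩ := ih _ hw
      refine ⟨e' :: es', ⟨⟨rfl, hw'⟩, rfl⟩, ?_⟩
      rintro (_ | ⟨f, fs⟩) ⟨hf, hm⟩
      · simp at hm
      · obtain ⟨hm₁, hm₂⟩ := List.cons_eq_cons.1 hm
        obtain rfl := hu f ⟨hf.1, hm₁⟩
        rw [hu' fs ⟨hf.2, hm₂⟩]
  obtain ⟨es', ⟨hw, hm⟩, hu⟩ := key p.edges v (h ▸ p.isWalk)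
  refine ⟨⟨v, es', by rw [← p.length_eq, ← hm, List.length_map], hw⟩,
    ⟨rfl, Path.ext h.symm hm⟩, ?_⟩
  rintro q ⟨rfl, rfl⟩
  exact Path.ext rfl (hu _ ⟨q.isWalk, rfl⟩)

/-- If every edge lifts uniquely to an edge with prescribed range, then so does every path. -/
theorem Hom.existsUnique_path_of_rng {V' Edge' : Type u} {H : DirGraph V' Edge'} (φ : Hom H G)
    (hφ : ∀ (w : V') (e : Edge), G.r e = φ.onV w → ∃! e', H.r e' = w ∧ φ.onE e' = e)
    {n : ℕ} (w : V') (p : G.Path n) (h : p.rng = φ.onV w) :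
    ∃! q : H.Path n, q.rng = w ∧ q.map φ = p := by
  have key : ∀ (es : List Edge) (v : V), G.IsWalk v es → G.walkEnd v es = φ.onV w →
      ∃! x : V' × List Edge', H.IsWalk x.1 x.2 ∧ H.walkEnd x.1 x.2 = w ∧ φ.onV x.1 = v ∧
        x.2.map φ.onE = es := by
    intro es
    induction es with
    | nil =>
      intro v _ hv
      refine ⟨(w, []), ⟨trivial, rfl, hv.symm, rfl⟩, ?_⟩
      rintro ⟨y, fs⟩ ⟨-, h₁, -, h₂⟩
      obtain rfl := List.map_eq_nil_iff.1 h₂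
      exact Prod.ext h₁ rfl
    | cons e es ih =>
      rintro v ⟨rfl, hw⟩ hend
      obtain ⟨⟨y, es'⟩, ⟨hw', rfl, hy, rfl⟩, hu'⟩ := ih _ hw hend
      obtain ⟨e', ⟨rfl, rfl⟩, hu⟩ := hφ y e hy.symm
      refine ⟨(H.s e', e' :: es'), ⟨⟨rfl, hw'⟩, rfl, (φ.s_onE e').symm, rfl⟩, ?_⟩
      rintro ⟨z, _ | ⟨f, fs⟩⟩ ⟨hf, hz, -, hm⟩
      · simp at hm
      · obtain ⟨hm₁, hm₂⟩ := List.cons_eq_cons.1 hm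
        have h₁ := hu' (H.r f, fs) ⟨hf.2, hz, by rw [← φ.r_onE, hm₁], hm₂⟩
        obtain ⟨hr, rfl⟩ := Prod.mk.inj h₁
        obtain rfl := hu f ⟨hr, hm₁⟩
        exact Prod.ext hf.1.symm rfl
  obtain ⟨⟨v, es'⟩, ⟨hw, hr, hv, hm⟩, hu⟩ := key p.edges p.src p.isWalk h
  refine ⟨⟨v, es', by rw [← p.length_eq, ← hm, List.length_map], hw⟩,
    ⟨hr, Path.ext hv hm⟩, ?_⟩
  rintro q ⟨hq, rfl⟩
  have := hu (q.src, q.edges) ⟨q.isWalk, hq, rfl, rfl⟩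
  exact Path.ext (congrArg Prod.fst this) (congrArg Prod.snd this)

end PathLemmas

/-! ### The composed graph -/

section Composition

variable {V Edge : Type u} {G : DirGraph V Edge} {k l : ℕ}

/-- Over `E_τ`, a path is determined by its source and its second label, which may be prescribed:
the edge with source `β` and second label `e` is `τ⁻¹(βe)`. -/
theorem existsUnique_path_secondLabel (τ : G.EndpointPerm (l + 1)) {m : ℕ} (γ : G.Path l)
    (p : G.Path m) (h : p.src = γ.rng) :
    ∃! B : (permDirGraph τ).Path m, B.src = γ ∧ secondLabel τ B = p := by
  refine (label₂Hom τ).existsUnique_path_of_src (fun β e he => ?_) γ p h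
  change G.s e = β.rng at he
  refine ⟨τ.toPerm.symm (β.snoc e he), ⟨?_, ?_⟩, ?_⟩
  · change (τ.toPerm _).init = β
    rw [Equiv.apply_symm_apply, Path.init_snoc]
  · change (τ.toPerm _).last = e
    rw [Equiv.apply_symm_apply, Path.last_snoc]
  · rintro μ ⟨h₁, h₂⟩
    rw [Equiv.eq_symm_apply]
    exact Path.ext_init_last (h₁.trans (β.init_snoc e he).symm) (h₂.trans (β.last_snoc e he).symm)

/-- Over `E_τ`, a path is determined by its range and its first label, which may be prescribed:
the edge with range `β` and first label `e` is `eβ`. -/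
theorem existsUnique_path_firstLabel (τ : G.EndpointPerm (l + 1)) {m : ℕ} (ω : G.Path l)
    (p : G.Path m) (h : p.rng = ω.src) :
    ∃! A : (permDirGraph τ).Path m, A.rng = ω ∧ firstLabel τ A = p := by
  refine (label₁Hom τ).existsUnique_path_of_rng (fun β e he => ?_) ω p h
  refine ⟨Path.cons e β he, ⟨Path.ext he rfl, rfl⟩, ?_⟩
  rintro μ ⟨h₁, h₂⟩
  exact Path.ext_head_tail h₂ (h₁.trans (Path.ext he.symm rfl))

theorem rng_firstLabel (τ : G.EndpointPerm (l + 1)) {m : ℕ} (A : (permDirGraph τ).Path m) :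
    (firstLabel τ A).rng = A.rng.src := Path.rng_map _ _

theorem rng_secondLabel (τ : G.EndpointPerm (l + 1)) {m : ℕ} (A : (permDirGraph τ).Path m) :
    (secondLabel τ A).rng = A.rng.rng := Path.rng_map _ _

/-- The path `δα'` over `E`, for the source `δ` and the second label `α'` of a path over `E_τ`. -/
def outputPath (τ : G.EndpointPerm (l + 1)) {m : ℕ} (A : (permDirGraph τ).Path m) :
    G.Path (l + m) :=
  A.src.append (secondLabel τ A) rfl

theorem outputPath_bijective (τ : G.EndpointPerm (l + 1)) (m : ℕ) :
    Function.Bijective (outputPath τ (m := m)) := by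
  constructor
  · intro A A' h
    obtain ⟨h₁, h₂⟩ := Path.append_inj h
    exact (existsUnique_path_secondLabel τ A'.src (secondLabel τ A') rfl).unique ⟨h₁, h₂⟩
      ⟨rfl, rfl⟩
  · intro p
    obtain ⟨γ, q, h, rfl⟩ := p.exists_append_eq
    obtain ⟨A, ⟨rfl, rfl⟩, -⟩ := existsUnique_path_secondLabel τ γ q h.symm
    exact ⟨A, rfl⟩

theorem rng_outputPath (τ : G.EndpointPerm (l + 1)) {m : ℕ} (A : (permDirGraph τ).Path m) :
    (outputPath τ A).rng = A.rng.rng :=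
  (Path.rng_append _ _ _).trans (rng_secondLabel τ A)

namespace CompEdge

variable {τ : G.EndpointPerm (l + 1)} {π : G.EndpointPerm (k + 1)}

theorem ext' {x y : CompEdge τ π} (he : x.edge = y.edge) (hA : x.A = y.A) (hB : x.B = y.B) :
    x = y := by
  cases x; cases y; cases he; cases hA; cases hB; rfl

theorem firstLabel_B (x : CompEdge τ π) : firstLabel τ x.B = π.toPerm x.edge :=
  Path.ext_init_last x.firstLabel_B_init x.firstLabel_B_last

theorem r_head_edge (x : CompEdge τ π) : G.r x.edge.head = (outputPath τ x.A).src :=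
  (congrArg Path.src x.firstLabel_A).symm

/-- The path `eδα'` for an edge of `Γ` with range `δα'` and first label `e`. -/
def inPath (x : CompEdge τ π) : G.Path (l + k + 1) :=
  Path.cons x.edge.head (outputPath τ x.A) x.r_head_edge

/-- The path `γβ'g` for an edge of `Γ` with source `γβ'` and second label `g`. -/
def outPath (x : CompEdge τ π) : G.Path (l + k + 1) := outputPath τ x.B

theorem src_outPath (x : CompEdge τ π) : x.outPath.src = x.inPath.src :=
  calc (firstLabel τ x.B).src = (π.toPerm x.edge).src := by rw [x.firstLabel_B]
    _ = x.edge.src := π.src_eq _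
    _ = G.s x.edge.head := x.edge.s_head.symm

theorem rng_outPath (x : CompEdge τ π) : x.outPath.rng = x.inPath.rng := by
  rw [outPath, inPath, rng_outputPath, Path.rng_cons, rng_outputPath, x.rng_eq]

/-- Given `eδα'`, the path `A` comes from `δα'`, the edge of `E_π` is `eα` for the first label `α`
of `A`, and `B` is the path with first label `π(eα)` and with the range of `A`. -/
theorem inPath_bijective : Function.Bijective (inPath : CompEdge τ π → _) := by
  constructor
  · intro x y h
    obtain ⟨he, hA⟩ := Path.cons_inj h
    have hA := (outputPath_bijective τ k).injective hA
    have he : x.edge = y.edge := Path.ext_head_tail he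
      (x.firstLabel_A.symm.trans ((congrArg _ hA).trans y.firstLabel_A))
    refine ext' he hA ?_
    refine (existsUnique_path_firstLabel τ y.B.rng (firstLabel τ y.B)
      (rng_firstLabel τ y.B)).unique ⟨?_, ?_⟩ ⟨rfl, rfl⟩
    · rw [← x.rng_eq, ← y.rng_eq, hA]
    · rw [x.firstLabel_B, y.firstLabel_B, he]
  · intro p
    obtain ⟨A, hA⟩ := (outputPath_bijective τ k).surjective p.tail
    have hr : G.r p.head = (firstLabel τ A).src := (congrArg Path.src hA).symm
    obtain ⟨B, ⟨hB, hB'⟩, -⟩ := existsUnique_path_firstLabel τ A.rng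
      (π.toPerm (Path.cons p.head (firstLabel τ A) hr))
      (by rw [π.rng_eq, Path.rng_cons, rng_firstLabel])
    refine ⟨⟨Path.cons p.head (firstLabel τ A) hr, A, B, ?_, congrArg Path.init hB',
      congrArg Path.last hB', hB.symm⟩, ?_⟩
    · exact Path.ext hr.symm rfl
    · conv_rhs => rw [← p.cons_head_tail]
      exact Path.ext rfl (congrArg (p.head :: ·) (congrArg Path.edges hA))

/-- Given `γβ'g`, the path `B` is determined, the edge of `E_π` is `π⁻¹` of the first label of `B`,
and `A` is the path whose first label is the range of this edge and whose range is that of `B`. -/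
theorem outPath_bijective : Function.Bijective (outPath : CompEdge τ π → _) := by
  constructor
  · intro x y h
    have hB := (outputPath_bijective τ (k + 1)).injective h
    have he : x.edge = y.edge := by
      apply π.toPerm.injective
      rw [← x.firstLabel_B, ← y.firstLabel_B, hB]
    refine ext' he ?_ hB
    refine (existsUnique_path_firstLabel τ y.A.rng (firstLabel τ y.A)
      (rng_firstLabel τ y.A)).unique ⟨?_, ?_⟩ ⟨rfl, rfl⟩
    · rw [x.rng_eq, y.rng_eq, hB]
    · rw [x.firstLabel_A, y.firstLabel_A, he]
  · intro p
    obtain ⟨B, hB⟩ := (outputPath_bijective τ (k + 1)).surjective p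
    obtain ⟨A, ⟨hA, hA'⟩, -⟩ := existsUnique_path_firstLabel τ B.rng
      (π.toPerm.symm (firstLabel τ B)).tail (by
        rw [Path.rng_tail, ← π.rng_eq, Equiv.apply_symm_apply, rng_firstLabel])
    refine ⟨⟨π.toPerm.symm (firstLabel τ B), A, B, hA', ?_, ?_, hA⟩, hB⟩
    · simp [permDirGraph]
    · simp [label₂]

end CompEdge

/-- The permutation `σ` with `σ(eδα') = γβ'g` for every edge of `Γ` from `γβ'` to `δα'` with labels
`[e, g]`. -/
noncomputable def compPerm (τ : G.EndpointPerm (l + 1)) (π : G.EndpointPerm (k + 1)) :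
    G.EndpointPerm (l + k + 1) where
  toPerm := (Equiv.ofBijective _ (CompEdge.inPath_bijective (τ := τ) (π := π))).symm.trans
    (Equiv.ofBijective _ CompEdge.outPath_bijective)
  src_eq p := by
    obtain ⟨x, rfl⟩ := (CompEdge.inPath_bijective (τ := τ) (π := π)).surjective p
    simp [Equiv.ofBijective_symm_apply_apply, x.src_outPath]
  rng_eq p := by
    obtain ⟨x, rfl⟩ := (CompEdge.inPath_bijective (τ := τ) (π := π)).surjective p
    simp [Equiv.ofBijective_symm_apply_apply, x.rng_outPath]

theorem compPerm_inPath {τ : G.EndpointPerm (l + 1)} {π : G.EndpointPerm (k + 1)}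
    (x : CompEdge τ π) : (compPerm τ π).toPerm x.inPath = x.outPath := by
  simp [compPerm, Equiv.ofBijective_symm_apply_apply]

theorem permGraph_compPerm_same (τ : G.EndpointPerm (l + 1)) (π : G.EndpointPerm (k + 1)) :
    (permGraph (compPerm τ π)).Same (compGraph τ π) := by
  refine ⟨(Equiv.ofBijective _ (CompEdge.inPath_bijective (τ := τ) (π := π))).symm, fun p => ?_⟩
  obtain ⟨x, rfl⟩ := (CompEdge.inPath_bijective (τ := τ) (π := π)).surjective p
  have hx := Equiv.ofBijective_symm_apply_apply _
    (CompEdge.inPath_bijective (τ := τ) (π := π)) x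
  refine ⟨(congrArg (compGraph τ π).graph.s hx).trans ?_,
    (congrArg (compGraph τ π).graph.r hx).trans ?_,
    (congrArg (compGraph τ π).label hx).trans (Prod.ext ?_ ?_)⟩
  · change _ = ((compPerm τ π).toPerm x.inPath).init
    rw [compPerm_inPath]
    exact (Path.init_append x.B.src (secondLabel τ x.B) rfl).symm
  · exact Path.ext x.r_head_edge.symm rfl
  · rfl
  · change _ = ((compPerm τ π).toPerm x.inPath).last
    rw [compPerm_inPath]
    exact (Path.last_append x.B.src (secondLabel τ x.B) rfl).symm

end Composition

/-! ### Permutation unitaries -/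

section Unitaries

namespace CKFamily

variable {V Edge : Type u} {G : DirGraph V Edge} [Fintype Edge]
  {B : Type u} [NonUnitalCStarAlgebra B] (F : CKFamily G B)

theorem walkS_append {v : V} {as bs : List Edge} (h : G.IsWalk v (as ++ bs)) :
    F.walkS v (as ++ bs) = F.walkS v as * F.walkS (G.walkEnd v as) bs := by
  classical
  induction as generalizing v with
  | nil => exact (F.P_mul_walkS v v h).trans (if_pos rfl) |>.symm
  | cons a as ih => rw [List.cons_append, walkS, ih h.2, walkS, walkEnd, mul_assoc]

theorem pathS_init_last {n : ℕ} (p : G.Path (n + 1)) :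
    F.pathS p = F.pathS p.init * F.S p.last := by
  have h := p.isWalk
  rw [← List.dropLast_append_getLast p.edges_ne_nil] at h
  have h₁ := F.walkS_append h
  rw [List.dropLast_append_getLast] at h₁
  refine h₁.trans (congrArg (F.pathS p.init * ·) ?_)
  exact F.S_mul_P _

theorem pathS_append {n m : ℕ} (p : G.Path n) (q : G.Path m) (h : p.rng = q.src) :
    F.pathS (p.append q h) = F.pathS p * F.pathS q := by
  have h' : G.walkEnd p.src p.edges = q.src := h
  refine (F.walkS_append (p.append q h).isWalk).trans ?_
  exact congrArg (fun v => F.pathS p * F.walkS v q.edges) h'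

theorem pathS_cons {n : ℕ} (e : Edge) (p : G.Path n) (h : G.r e = p.src) :
    F.pathS (Path.cons e p h) = F.S e * F.pathS p := by
  simp only [pathS, Path.cons, walkS, h]

theorem map_pathS {C : Type u} [NonUnitalCStarAlgebra C] {F : CKFamily G B} {F' : CKFamily G C}
    (φ : B →⋆ₙₐ[ℂ] C) (hP : ∀ v, φ (F.P v) = F'.P v) (hS : ∀ e, φ (F.S e) = F'.S e) {n : ℕ}
    (p : G.Path n) : φ (F.pathS p) = F'.pathS p := by
  have key : ∀ (es : List Edge) (v : V), φ (F.walkS v es) = F'.walkS v es := by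
    intro es
    induction es with
    | nil => exact hP
    | cons e es ih => intro v; rw [walkS, map_mul, hS, ih, walkS]
  exact key _ _

variable [Fintype V]

theorem map_permUnitary {C : Type u} [NonUnitalCStarAlgebra C] {F : CKFamily G B}
    {F' : CKFamily G C} (φ : B →⋆ₙₐ[ℂ] C) (hP : ∀ v, φ (F.P v) = F'.P v)
    (hS : ∀ e, φ (F.S e) = F'.S e) {n : ℕ} (τ : G.EndpointPerm n) :
    φ (F.permUnitary τ) = F'.permUnitary τ := by
  simp only [permUnitary, map_sum, map_mul, map_star, map_pathS φ hP hS]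

theorem permUnitary_mul_pathS {n : ℕ} (τ : G.EndpointPerm n) (p : G.Path n) :
    F.permUnitary τ * F.pathS p = F.pathS (τ.toPerm p) := by
  classical
  rw [permUnitary, Finset.sum_mul, Finset.sum_eq_single p]
  · rw [mul_assoc, F.star_pathS_mul_pathS, if_pos rfl, ← τ.rng_eq, F.pathS_mul_P]
  · intro q _ hq
    rw [mul_assoc, F.star_pathS_mul_pathS, if_neg hq, mul_zero]
  · simp

/-- Since `∑ S_α S_α^*`, over the paths `α` of a fixed length, acts as a unit on the `S_e`, the
products with the `S_α` determine those with the `S_e`. -/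
theorem mul_S_eq_of_mul_pathS_eq (hG : G.NoSinks) {n : ℕ} {a b : B}
    (h : ∀ p : G.Path n, a * F.pathS p = b * F.pathS p) (e : Edge) : a * F.S e = b * F.S e := by
  rw [← F.sum_P_mul_S e, ← F.sum_pathS_mul_star hG n]
  simp only [Finset.sum_mul, Finset.mul_sum, ← mul_assoc, h]

/-- The image of `S_α` under `λ_τ`, for the first label `α` of a path over `E_τ`, multiplied by
`S_ω` for the range `ω` of that path, is `S_{δα'}`. -/
theorem permute_pathS_firstLabel_mul (hG : G.NoSinks) {l m : ℕ} (τ : G.EndpointPerm (l + 1))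
    (A : (permDirGraph τ).Path m) :
    (F.permute hG τ).pathS (firstLabel τ A) * F.pathS A.rng = F.pathS (outputPath τ A) := by
  classical
  have key : ∀ (ms : List (G.Path (l + 1))) (β : G.Path l), (permDirGraph τ).IsWalk β ms →
      (F.permute hG τ).walkS β.src (ms.map (label₁ τ)) *
        F.pathS ((permDirGraph τ).walkEnd β ms) =
      F.pathS β * F.walkS β.rng (ms.map (label₂ τ)) := by
    intro ms
    induction ms with
    | nil =>
      intro β _
      exact ((F.P_mul_pathS _ β).trans (if_pos rfl)).trans (F.pathS_mul_P β).symm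
    | cons μ ms ih =>
      rintro β ⟨rfl, hw⟩
      have h₁ : (permDirGraph τ).r μ = μ.tail := rfl
      have h₂ : G.r (label₂ τ μ) = μ.tail.rng := (label₂Hom τ).r_onE μ
      calc F.permUnitary τ * F.S μ.head * (F.permute hG τ).walkS μ.tail.src
              (ms.map (label₁ τ)) * F.pathS ((permDirGraph τ).walkEnd μ.tail ms)
          = F.permUnitary τ * (F.S μ.head * F.pathS μ.tail) *
              F.walkS μ.tail.rng (ms.map (label₂ τ)) := by
            rw [mul_assoc, ih μ.tail hw]; simp only [mul_assoc]
        _ = F.pathS ((permDirGraph τ).s μ) * (F.S (label₂ τ μ) *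
              F.walkS (G.r (label₂ τ μ)) (ms.map (label₂ τ))) := by
            rw [← F.pathS_head_tail, F.permUnitary_mul_pathS, F.pathS_init_last, h₂, mul_assoc]
            rfl
  exact (key A.edges A.src A.isWalk).trans (F.pathS_append A.src (secondLabel τ A) rfl).symm

theorem permute_permUnitary_mul (hG : G.NoSinks) {l k : ℕ} (τ : G.EndpointPerm (l + 1))
    (π : G.EndpointPerm (k + 1)) (e : Edge) :
    (F.permute hG τ).permUnitary π * (F.permUnitary τ * F.S e) =
      F.permUnitary (compPerm τ π) * F.S e := by
  rw [← mul_assoc]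
  refine F.mul_S_eq_of_mul_pathS_eq hG (n := l + k + 1) (fun p => ?_) e
  obtain ⟨x, rfl⟩ := (CompEdge.inPath_bijective (τ := τ) (π := π)).surjective p
  have hedge : F.permUnitary τ * F.S x.edge.head * (F.permute hG τ).pathS (firstLabel τ x.A) =
      (F.permute hG τ).pathS x.edge := by
    rw [x.firstLabel_A]
    exact ((F.permute hG τ).pathS_head_tail x.edge).symm
  rw [F.permUnitary_mul_pathS, compPerm_inPath, CompEdge.inPath, F.pathS_cons,
    ← F.permute_pathS_firstLabel_mul hG, CompEdge.outPath, ← F.permute_pathS_firstLabel_mul hG,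
    x.firstLabel_B, ← x.rng_eq, ← (F.permute hG τ).permUnitary_mul_pathS, ← hedge]
  simp only [mul_assoc]

/-- If the `P_v` do not vanish, the elements `U_τ S_e` determine `τ`. -/
theorem eq_of_permUnitary_mul_S_eq (hP : ∀ v, F.P v ≠ 0) {n : ℕ} {σ ρ : G.EndpointPerm (n + 1)}
    (h : ∀ e, F.permUnitary ρ * F.S e = F.permUnitary σ * F.S e) : ρ = σ := by
  classical
  have hp : ∀ p, ρ.toPerm p = σ.toPerm p := by
    intro p
    have hS : F.pathS (ρ.toPerm p) = F.pathS (σ.toPerm p) := by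
      rw [← F.permUnitary_mul_pathS, ← F.permUnitary_mul_pathS, F.pathS_head_tail, ← mul_assoc, h,
        mul_assoc]
    by_contra hne
    have h₁ := F.star_pathS_mul_pathS (ρ.toPerm p) (σ.toPerm p)
    rw [← hS, F.star_pathS_mul_pathS, if_pos rfl, if_neg hne] at h₁
    exact hP _ h₁
  obtain ⟨ρ, _, _⟩ := ρ
  obtain ⟨σ, _, _⟩ := σ
  obtain rfl : ρ = σ := Equiv.ext hp
  rfl

end CKFamily

theorem permEndo_compPerm {V Edge : Type u} [Fintype V] [Fintype Edge] {G : DirGraph V Edge}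
    (hG : G.NoSinks) {l k : ℕ} (τ : G.EndpointPerm (l + 1)) (π : G.EndpointPerm (k + 1)) :
    permEndo hG (compPerm τ π) = (permEndo hG τ).comp (permEndo hG π) := by
  refine CStarAlg.hom_ext (fun v => ?_) (fun e => ?_)
  · rw [NonUnitalStarAlgHom.comp_apply, permEndo_P, permEndo_P, permEndo_P]
  · rw [NonUnitalStarAlgHom.comp_apply, permEndo_S, permEndo_S, map_mul, permEndo_S,
      CKFamily.map_permUnitary (F' := (univFamily G).permute hG τ) (permEndo hG τ)
        (permEndo_P hG τ) (permEndo_S hG τ), CKFamily.permute_permUnitary_mul]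

end Unitaries
/-! ### A Cuntz-Krieger family with nonvanishing projections -/

section Representation

open scoped ENNReal

/-- The square sum of a sequence does not increase under composition with a partial injection. -/
theorem sum_norm_elim_rpow_le {X : Type u} (f : X ≃. X) (ξ : lp (fun _ : X => ℂ) 2)
    (s : Finset X) :
    ∑ x ∈ s, ‖(f x).elim 0 ξ‖ ^ (2 : ℝ≥0∞).toReal ≤ ‖ξ‖ ^ (2 : ℝ≥0∞).toReal := by
  refine le_trans (le_of_eq ?_) (lp.sum_rpow_le_norm_rpow (by simp) ξ
    (s.filterMap f fun _ _ _ => f.inj))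
  refine Finset.sum_bij_ne_zero
    (fun x _ h => (f x).get (Option.isSome_iff_ne_none.2 fun h' => h (by simp [h'])))
    ?_ ?_ ?_ ?_
  · intro x hx h
    exact (Finset.mem_filterMap _).2 ⟨x, hx, by simp⟩
  · intro x _ _ y _ _ hxy
    exact f.inj (Option.get_mem _) (by rw [hxy]; exact Option.get_mem _)
  · intro y hy h
    obtain ⟨x, hx, hxy⟩ := (Finset.mem_filterMap _).1 hy
    exact ⟨x, hx, by simpa [hxy] using h, by simp [hxy]⟩
  · intro x _ h
    obtain ⟨y, hy⟩ := Option.ne_none_iff_exists'.1 fun h' : f x = none => h (by simp [h'])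
    simp [hy]

/-- The operator `(Tξ)(x) = ξ(f(x))` on `ℓ²(X)` given by a partial injection `f`, where `(Tξ)(x) = 0`
if `f(x)` is not defined. -/
noncomputable def pullbackOp {X : Type u} (f : X ≃. X) :
    lp (fun _ : X => ℂ) 2 →L[ℂ] lp (fun _ : X => ℂ) 2 :=
  LinearMap.mkContinuous
    { toFun := fun ξ => ⟨fun x => (f x).elim 0 ξ, memℓp_gen' (sum_norm_elim_rpow_le f ξ)⟩
      map_add' := fun ξ η => lp.ext (funext fun x => by
        change (f x).elim 0 (ξ + η) = (f x).elim 0 ξ + (f x).elim 0 η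
        cases f x
        · exact (add_zero 0).symm
        · rfl)
      map_smul' := fun c ξ => lp.ext (funext fun x => by
        change (f x).elim 0 (c • ξ) = c • (f x).elim 0 ξ
        cases f x
        · exact (smul_zero c).symm
        · rfl) }
    1 (fun ξ => by
      rw [one_mul]
      exact lp.norm_le_of_forall_sum_le (by simp) (norm_nonneg ξ) (sum_norm_elim_rpow_le f ξ))

theorem pullbackOp_apply {X : Type u} (f : X ≃. X) (ξ : lp (fun _ : X => ℂ) 2) (x : X) :
    pullbackOp f ξ x = (f x).elim 0 ξ := rfl

theorem pullbackOp_mul {X : Type u} (f g : X ≃. X) :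
    pullbackOp f * pullbackOp g = pullbackOp (f.trans g) := by
  refine ContinuousLinearMap.ext fun ξ => lp.ext (funext fun x => ?_)
  rw [mul_apply_eq_comp, pullbackOp_apply, pullbackOp_apply]
  change _ = ((f x).bind g).elim 0 ξ
  cases f x <;> rfl

theorem pullbackOp_bot {X : Type u} : pullbackOp (⊥ : X ≃. X) = 0 :=
  ContinuousLinearMap.ext fun _ => lp.ext rfl

theorem star_pullbackOp {X : Type u} (f : X ≃. X) :
    star (pullbackOp f) = pullbackOp f.symm := by
  classical
  refine ContinuousLinearMap.ext fun ξ => lp.ext (funext fun y => ?_)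
  -- The coordinate at `y` of the adjoint is an inner product with the image of the basis vector.
  have h₁ : pullbackOp f (lp.single 2 y 1) =
      (f.symm y).elim 0 fun x => (lp.single 2 x 1 : lp (fun _ : X => ℂ) 2) := by
    refine lp.ext (funext fun x => ?_)
    rw [pullbackOp_apply]
    cases hy : f.symm y with
    | none =>
      cases hx : f x with
      | none => rfl
      | some z =>
        have : z ≠ y := by
          rintro rfl
          rw [f.eq_some_iff.2 hx] at hy
          cases hy
        simp [this]
    | some w =>
      have hw := f.eq_some_iff.1 hy
      by_cases hxw : x = w
      · subst hxw; simp [hw]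
      · cases hx : f x with
        | none => simp [hxw]
        | some z =>
          have : z ≠ y := by
            rintro rfl
            exact hxw (f.inj hx hw)
          simp [this, hxw]
  have h₂ := ContinuousLinearMap.adjoint_inner_right (pullbackOp f) (lp.single 2 y 1) ξ
  rw [h₁, lp.inner_single_left] at h₂
  rw [ContinuousLinearMap.star_eq_adjoint, pullbackOp_apply]
  refine Eq.trans (by simp) (h₂.trans ?_)
  cases f.symm y with
  | none => simp
  | some x => simp [lp.inner_single_left]

variable {V Edge : Type u} {G : DirGraph V Edge} [Fintype Edge]

/-- Every vertex emits finitely many and at least one edge, so `ℕ` is a disjoint union of copies of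
`ℕ`, one for each edge that it emits. -/
theorem exists_branching (hG : G.NoSinks) :
    ∃ Φ : Edge × ℕ ≃ V × ℕ, ∀ x, (Φ x).1 = G.s x.1 := by
  have hne (v : V) : Nonempty {e // G.s e = v} := let ⟨e, he⟩ := hG v; ⟨⟨e, he⟩⟩
  have hden (v : V) : Nonempty ({e // G.s e = v} × ℕ ≃ ℕ) := by
    have := hne v
    have : Countable {e // G.s e = v} := Finite.to_countable
    exact nonempty_equiv_of_countable
  let Ψ (v : V) : {e // G.s e = v} × ℕ ≃ ℕ := (hden v).some
  refine ⟨⟨fun x => (G.s x.1, Ψ _ (⟨x.1, rfl⟩, x.2)),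
    fun y => (((Ψ y.1).symm y.2).1.1, ((Ψ y.1).symm y.2).2), ?_, ?_⟩, fun _ => rfl⟩
  · rintro ⟨e, n⟩
    simp
  · rintro ⟨v, n⟩
    refine Prod.ext ((Ψ v).symm n).1.2 ?_
    have key : ∀ x : {e // G.s e = v} × ℕ, Ψ _ (⟨x.1.1, rfl⟩, x.2) = Ψ v x := by
      rintro ⟨⟨e, rfl⟩, m⟩
      rfl
    exact (key _).trans ((Ψ v).apply_symm_apply n)

open Classical in
/-- The partial injection `Φ(e, n) ↦ (r(e), n)`. -/
noncomputable def edgePEquiv (G : DirGraph V Edge) (Φ : Edge × ℕ ≃ V × ℕ) (e : Edge) :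
    V × ℕ ≃. V × ℕ where
  toFun x := if (Φ.symm x).1 = e then some (G.r e, (Φ.symm x).2) else none
  invFun y := if y.1 = G.r e then some (Φ (e, y.2)) else none
  inv x y := by
    obtain ⟨⟨f, n⟩, rfl⟩ := Φ.surjective x
    obtain ⟨w, m⟩ := y
    rw [Equiv.symm_apply_apply]
    constructor <;> intro h <;> split_ifs at h ⊢ <;> simp_all

open Classical in
/-- There is a Cuntz-Krieger family, on the Hilbert space `ℓ²(V × ℕ)`, in which no `P_v` vanishes.
-/
theorem exists_family_P_ne_zero (hG : G.NoSinks) :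
    ∃ (B : Type u) (_ : NonUnitalCStarAlgebra B) (F : CKFamily G B), ∀ v, F.P v ≠ 0 := by
  obtain ⟨Φ, hΦ⟩ := exists_branching hG
  have hP (v : V) (ξ : lp (fun _ : V × ℕ => ℂ) 2) (x : V × ℕ) :
      pullbackOp (PEquiv.ofSet {x | x.1 = v}) ξ x = if x.1 = v then ξ x else 0 := by
    rw [pullbackOp_apply]
    change (if x.1 = v then some x else none).elim 0 ξ = _
    split_ifs <;> rfl
  have hSS (e : Edge) (ξ : lp (fun _ : V × ℕ => ℂ) 2) (x : V × ℕ) :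
      (pullbackOp (edgePEquiv G Φ e) * star (pullbackOp (edgePEquiv G Φ e))) ξ x =
        if (Φ.symm x).1 = e then ξ x else 0 := by
    rw [star_pullbackOp, pullbackOp_mul, PEquiv.self_trans_symm, pullbackOp_apply]
    change (if ((if (Φ.symm x).1 = e then some (G.r e, (Φ.symm x).2) else none :
      Option (V × ℕ))).isSome then some x else none).elim 0 ξ = _
    split_ifs <;> simp_all
  have hs (x : V × ℕ) : G.s (Φ.symm x).1 = x.1 := by rw [← hΦ, Equiv.apply_symm_apply]
  refine ⟨lp (fun _ : V × ℕ => ℂ) 2 →L[ℂ] lp (fun _ : V × ℕ => ℂ) 2, inferInstance,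
    { P := fun v => pullbackOp (PEquiv.ofSet {x | x.1 = v})
      S := fun e => pullbackOp (edgePEquiv G Φ e)
      isStarProjection_P := fun v => ⟨?_, ?_⟩
      P_mul_P := fun v w h => ?_
      star_S_mul_S := fun e => ?_
      star_S_mul_S_of_ne := fun e f h => ?_
      range_S_le := fun e => ?_
      P_eq_sum := fun v _ => ?_ }, fun v h => ?_⟩
  · refine ContinuousLinearMap.ext fun ξ => lp.ext (funext fun x => ?_)
    rw [mul_apply_eq_comp, hP, hP]
    split_ifs <;> rfl
  · rw [IsSelfAdjoint, star_pullbackOp, PEquiv.ofSet_symm]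
  · refine ContinuousLinearMap.ext fun ξ => lp.ext (funext fun x => ?_)
    rw [mul_apply_eq_comp, hP, hP]
    split_ifs with h₁ h₂
    · exact absurd (h₁.symm.trans h₂) h
    · rfl
    · rfl
  · rw [star_pullbackOp, pullbackOp_mul, PEquiv.symm_trans_self]
    refine ContinuousLinearMap.ext fun ξ => lp.ext (funext fun x => ?_)
    rw [hP, pullbackOp_apply]
    change (if ((if x.1 = G.r e then some (Φ (e, x.2)) else none :
      Option (V × ℕ))).isSome then some x else none).elim 0 ξ = _
    split_ifs <;> simp_all
  · rw [star_pullbackOp, pullbackOp_mul, ← pullbackOp_bot]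
    congr 1
    refine PEquiv.ext fun x => ?_
    change (if x.1 = G.r e then some (Φ (e, x.2)) else none : Option (V × ℕ)).bind
      (edgePEquiv G Φ f) = none
    split_ifs
    · change (if (Φ.symm (Φ (e, x.2))).1 = f then _ else none) = none
      rw [Equiv.symm_apply_apply, if_neg h]
    · rfl
  · refine ContinuousLinearMap.ext fun ξ => lp.ext (funext fun x => ?_)
    rw [mul_apply_eq_comp, hP, hSS, ← hs x]
    split_ifs with h₁ h₂ h₂
    · rfl
    · rfl
    · exact absurd (congrArg G.s h₂) h₁
    · rfl
  · refine ContinuousLinearMap.ext fun ξ => lp.ext (funext fun x => ?_)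
    rw [sum_apply, lp.coeFn_sum, Finset.sum_apply, hP]
    simp only [hSS, Finset.sum_ite_eq, Finset.mem_filter, Finset.mem_univ, true_and, hs]
  · have h₁ := hP v (lp.single 2 (v, 0) 1) (v, 0)
    rw [show pullbackOp (PEquiv.ofSet {x : V × ℕ | x.1 = v}) = 0 from h] at h₁
    simp at h₁

theorem univFamily_P_ne_zero (hG : G.NoSinks) (v : V) : (univFamily G).P v ≠ 0 := by
  obtain ⟨B, _, F, hF⟩ := exists_family_P_ne_zero hG
  intro h
  apply hF v
  rw [← CStarAlg.lift_P, h, map_zero]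

theorem permEndo_injective [Fintype V] (hG : G.NoSinks) {n : ℕ} :
    Function.Injective (permEndo hG : G.EndpointPerm (n + 1) → _) := fun ρ σ h =>
  (univFamily G).eq_of_permUnitary_mul_S_eq (univFamily_P_ne_zero hG) fun e => by
    rw [← permEndo_S hG, h, permEndo_S]

end Representation

end DirGraph

theorem mainTheorem9 {V Edge : Type u} [Fintype V] [Fintype Edge] (G : DirGraph V Edge)
    (hsink : G.NoSinks) (hsource : G.NoSources) (hexit : G.EveryCycleHasExit)
    (l k : ℕ) (τ : G.EndpointPerm (l + 1)) (π : G.EndpointPerm (k + 1)) :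
    ∃ σ : G.EndpointPerm (l + k + 1),
      (∀ ρ : G.EndpointPerm (l + k + 1),
        DirGraph.permEndo hsink ρ =
          (DirGraph.permEndo hsink τ).comp (DirGraph.permEndo hsink π) ↔ ρ = σ) ∧
      (DirGraph.permGraph σ).Same (DirGraph.compGraph τ π) := by
  refine ⟨DirGraph.compPerm τ π, fun ρ => ?_, DirGraph.permGraph_compPerm_same τ π⟩
  rw [← DirGraph.permEndo_compPerm]
  exact (DirGraph.permEndo_injective hsink).eq_iff
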